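/- Let $A$ be a finite set with $J \ge 0$ elements and let $B_J = \mathcal{P}(A)$ be the Boolean algebra of subsets of $A$. For a binary operation $\star$ on a set $X$ put $C_n(X) = \mathbb{Z}X^{n+1}$ for $n \ge 0$ and $$\partial_n^{\star}(x_0,\dots,x_n) = \sum_{i=0}^n (-1)^i (x_0\star x_i,\dots,x_{i-1}\star x_i, x_{i+1},\dots,x_n) \qquad (n\ge 1).$$ For integers $a,b,c,d$ the four-term chain complex of a distributive lattice $L$ with scalars $(a,b,c,d)$ is $C_\bullet(L)$, with $C_n(L)=0$ for $n<0$ and differential $\partial = a\,\partial^{\vdash} + b\,\partial^{\vee} + c\,\partial^{\wedge} + d\,\partial^{\dashv}$, where $x\vdash y = x$ and $x \dashv y = y$; its homology is denoted by $H_n(L)$. The augmented homology $\tilde H_n(L)$ is the homology of the complex extended by $C_{-1} = \mathbb{Z}$ and $\partial_0(x) = 1$ for all $x\in L$. For all integers $a,b,c$ and all $n\ge 0$, the four-term homology of $B_J$ with scalars $(a,b,c,0)$ satisfies $$\operatorname{rk} H_n(B_J) = \begin{cases} |B_J|^{n+1} = 2^{J(n+1)}, & a=b=c=0,\\ J\,2^n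 + \delta_{0,n}, & b=c=-a\neq 0,\\ 1, & a+b+c=0 \text{ and } (a,b,c)\neq(0,0,0),\\ \delta_{0,n}, & \text{otherwise,}\end{cases}$$ and the augmented homology satisfies $\operatorname{rk}\tilde H_n(B_J) + \delta_{0,n} = \operatorname{rk} H_n(B_J)$. Here $\delta_{0,n}$ is $1$ if $n=0$ and $0$ otherwise. -/

import Mathlib

open CategoryTheory

namespace DistributiveHomology

/-- The face map `d_i^⋆ (x_0, …, x_n) = (x_0 ⋆ x_i, …, x_{i-1} ⋆ x_i, x_{i+1}, …, x_n)`
attached to a binary operation `⋆`, on tuples of length at least two. -/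
def face {X : Type*} (op : X → X → X) {n : ℕ} (i : Fin (n + 2)) (x : Fin (n + 2) → X) :
    Fin (n + 1) → X :=
  fun k => if k.castSucc < i then op (x k.castSucc) (x i) else x k.succ

/-- The chain group `C_n(X; R)`: the free `R`-module on `X^{n+1}`. -/
abbrev Chain (R X : Type*) [CommRing R] (n : ℕ) : Type _ :=
  (Fin (n + 1) → X) →₀ R

/-- The one-term differential `∂^⋆ = ∑_i (-1)^i d_i^⋆ : C_{n+1} → C_n`. -/
noncomputable def oneTermDifferential (R : Type*) {X : Type*} [CommRing R] (op : X → X → X)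
    (n : ℕ) : Chain R X (n + 1) →ₗ[R] Chain R X n :=
  ∑ i : Fin (n + 2), (-1 : R) ^ (i : ℕ) • Finsupp.lmapDomain R R (face op i)

/-- The multi-term differential `∂ = ∑_r a_r ∂^{⋆_r} : C_{n+1} → C_n` attached to operations
`⋆_r` and scalars `a_r`. -/
noncomputable def differential {R X : Type*} [CommRing R] {k : ℕ} (ops : Fin k → X → X → X)
    (a : Fin k → R) (n : ℕ) : Chain R X (n + 1) →ₗ[R] Chain R X n :=
  ∑ r : Fin k, a r • oneTermDifferential R (ops r) n

/-- The augmentation `C_0 → C_{-1} = R`, sending each `x` in `X` to `1`. -/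
noncomputable def augmentation (R X : Type*) [CommRing R] : Chain R X 0 →ₗ[R] R :=
  Finsupp.linearCombination R (fun _ : Fin 1 → X => (1 : R))

section Complex

variable {R X : Type*} [CommRing R] {k : ℕ}

/-- Every two (possibly equal) operations of the family are mutually right distributive:
`(x ⋆_s y) ⋆_r z = (x ⋆_r z) ⋆_s (y ⋆_r z)`. -/
def IsDistributive (ops : Fin k → X → X → X) : Prop :=
  ∀ r s : Fin k, ∀ x y z : X,
    ops r (ops s x y) z = ops s (ops r x z) (ops r y z)

theorem face_face {ops : Fin k → X → X → X} (h : IsDistributive ops) (r s : Fin k) {n : ℕ}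
    {i j : Fin (n + 2)} (hij : i ≤ j) (x : Fin (n + 3) → X) :
    face (ops r) i (face (ops s) j.succ x) = face (ops s) j (face (ops r) i.castSucc x) := by
  funext m
  have h' := h s r
  rcases i with ⟨i, hi⟩
  rcases j with ⟨j, hj⟩
  rcases m with ⟨m, hm⟩
  simp only [Fin.mk_le_mk] at hij
  simp only [face, Fin.lt_def, Fin.castSucc_mk, Fin.succ_mk]
  split_ifs <;> first | rfl | omega | exact (h' _ _ _).symm

theorem comp_sum_aux {M N P ι κ : Type*} [AddCommMonoid M] [AddCommMonoid N] [AddCommMonoid P]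
    [Module R M] [Module R N] [Module R P] [Fintype ι] [Fintype κ] (f : ι → N →ₗ[R] P)
    (g : κ → M →ₗ[R] N) : (∑ i, f i) ∘ₗ (∑ j, g j) = ∑ i, ∑ j, f i ∘ₗ g j := by
  ext x
  simp [LinearMap.sum_apply, map_sum]

/-- The multi-term face map `d_i = ∑_r a_r d_i^{⋆_r}`. -/
noncomputable def multiFace (ops : Fin k → X → X → X) (a : Fin k → R) {n : ℕ} (i : Fin (n + 2)) :
    Chain R X (n + 1) →ₗ[R] Chain R X n :=
  ∑ r : Fin k, a r • Finsupp.lmapDomain R R (face (ops r) i)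

theorem differential_eq (ops : Fin k → X → X → X) (a : Fin k → R) (n : ℕ) :
    differential ops a n = ∑ i : Fin (n + 2), (-1 : R) ^ (i : ℕ) • multiFace ops a i := by
  simp only [differential, oneTermDifferential, multiFace, Finset.smul_sum]
  rw [Finset.sum_comm]
  refine Finset.sum_congr rfl fun i _ => Finset.sum_congr rfl fun r _ => ?_
  rw [smul_comm]

theorem multiFace_comp {ops : Fin k → X → X → X} (h : IsDistributive ops) (a : Fin k → R) {n : ℕ}
    {i j : Fin (n + 2)} (hij : i ≤ j) :
    multiFace ops a i ∘ₗ multiFace ops a j.succ =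
      multiFace ops a j ∘ₗ multiFace ops a i.castSucc := by
  simp only [multiFace, comp_sum_aux, LinearMap.smul_comp, LinearMap.comp_smul]
  rw [Finset.sum_comm]
  refine Finset.sum_congr rfl fun s _ => Finset.sum_congr rfl fun r _ => ?_
  rw [smul_comm]
  congr 2
  refine Finsupp.lhom_ext fun x c => ?_
  simp only [LinearMap.comp_apply, Finsupp.lmapDomain_apply, Finsupp.mapDomain_single,
    face_face h r s hij x]

theorem differential_comp {ops : Fin k → X → X → X} (h : IsDistributive ops) (a : Fin k → R)
    (n : ℕ) : differential ops a n ∘ₗ differential ops a (n + 1) = 0 := by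
  simp only [differential_eq, comp_sum_aux, ← Finset.sum_product']
  let P := Fin (n + 2) × Fin (n + 3)
  let S : Finset P := {ij : P | (ij.2 : ℕ) ≤ (ij.1 : ℕ)}
  rw [Finset.univ_product_univ, ← Finset.sum_add_sum_compl S]
  suffices hS : ∑ p ∈ S, ((-1 : R) ^ (p.1 : ℕ) • multiFace ops a p.1) ∘ₗ
      ((-1 : R) ^ (p.2 : ℕ) • multiFace ops a p.2) =
      (-1 : R) • ∑ p ∈ Sᶜ, ((-1 : R) ^ (p.1 : ℕ) • multiFace ops a p.1) ∘ₗ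
      ((-1 : R) ^ (p.2 : ℕ) • multiFace ops a p.2) by
    rw [hS]
    nth_rewrite 2 [← one_smul R (∑ p ∈ Sᶜ, _)]
    rw [← add_smul, neg_add_cancel, zero_smul]
  rw [Finset.smul_sum]
  let φ : ∀ ij : P, ij ∈ S → P := fun ij hij =>
    (Fin.castLT ij.2 (lt_of_le_of_lt (Finset.mem_filter.mp hij).right (Fin.is_lt ij.1)), ij.1.succ)
  apply Finset.sum_bij φ
  · intro ij hij
    simp_rw [S, φ, Finset.compl_filter, Finset.mem_filter_univ, Fin.val_succ,
      Fin.val_castLT] at hij ⊢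
    lia
  · rintro ⟨i, j⟩ hij ⟨i', j'⟩ hij' h
    rw [Prod.mk_inj]
    exact ⟨by simpa [φ] using! congr_arg Prod.snd h,
      by simpa [φ, Fin.castSucc_castLT] using! congr_arg Fin.castSucc (congr_arg Prod.fst h)⟩
  · rintro ⟨i', j'⟩ hij'
    simp_rw [S, Finset.compl_filter, Finset.mem_filter_univ, not_le] at hij'
    refine ⟨(j'.pred <| ?_, Fin.castSucc i'), ?_, ?_⟩
    · rintro rfl
      simp only [Fin.val_zero, not_lt_zero] at hij'
    · simpa [S] using! Nat.le_sub_one_of_lt hij'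
    · simp only [φ, Fin.castLT_castSucc, Fin.succ_pred]
  · rintro ⟨i, j⟩ hij
    have hle : (j : ℕ) ≤ i := by simpa [S] using! hij
    have hlt : (j : ℕ) < n + 2 := lt_of_le_of_lt hle i.isLt
    have key := multiFace_comp h a (i := j.castLT hlt) (j := i) hle
    rw [Fin.castSucc_castLT] at key
    simp only [φ, LinearMap.smul_comp, LinearMap.comp_smul, key, smul_smul]
    congr 1
    simp only [Fin.val_succ, Fin.val_castLT, pow_succ]
    ring

theorem augmentation_comp (ops : Fin k → X → X → X) (a : Fin k → R) :
    augmentation R X ∘ₗ differential ops a 0 = 0 := by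
  refine Finsupp.lhom_ext fun x c => ?_
  simp [augmentation, differential, oneTermDifferential, Fin.sum_univ_succ,
    Finsupp.mapDomain_single, -Finsupp.smul_single,
    -Algebra.smul_mul_assoc, map_smul]

/-- The multi-term chain complex `(C(X; R), ∂)` of a set with a distributive family of operations
`⋆_r` and scalars `a_r`, concentrated in degrees `n ≥ 0`. -/
noncomputable def chainComplex (ops : Fin k → X → X → X) (h : IsDistributive ops)
    (a : Fin k → R) : ChainComplex (ModuleCat R) ℕ :=
  ChainComplex.of (fun n => ModuleCat.of R (Chain R X n))
    (fun n => ModuleCat.ofHom (differential ops a n))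
    (fun n => by rw [← ModuleCat.ofHom_comp, differential_comp h a n]; rfl)

/-- The augmented multi-term chain complex, with `R` in degree `-1` and the augmentation as its
last differential. Mathlib's `ChainComplex.augment` shifts the indexing by one: the term of
degree `n` sits at index `n + 1`. (`ULift` only adjusts the universe.) -/
noncomputable def augmentedChainComplex {R : Type*} {X : Type*} [CommRing R]
    (ops : Fin k → X → X → X) (h : IsDistributive ops)
    (a : Fin k → R) : ChainComplex (ModuleCat R) ℕ :=
  (chainComplex ops h a).augment (X := ModuleCat.of R (ULift R))
    (ModuleCat.ofHom (ULift.moduleEquiv.symm.toLinearMap ∘ₗ augmentation R X))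
    (by
      have : (chainComplex ops h a).d 1 0 = ModuleCat.ofHom (differential ops a 0) :=
        ChainComplex.of_d (fun n => ModuleCat.of R (Chain R X n))
          (fun n => ModuleCat.ofHom (differential ops a n)) 0
      rw [this]
      refine ModuleCat.hom_ext ?_
      change (ULift.moduleEquiv.symm.toLinearMap ∘ₗ augmentation R X) ∘ₗ differential ops a 0 = 0
      rw [LinearMap.comp_assoc, augmentation_comp, LinearMap.comp_zero])

end Complex

/-- The four operations of a lattice: left projection, join, meet, right projection. -/
def latticeOps (L : Type*) [Lattice L] : Fin 4 → L → L → L :=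
  ![fun x _ => x, fun x y => x ⊔ y, fun x y => x ⊓ y, fun _ y => y]

theorem isDistributive_latticeOps (L : Type*) [DistribLattice L] :
    IsDistributive (latticeOps L) := by
  intro r s x y z
  fin_cases r <;> fin_cases s <;>
    first
    | rfl
    | exact (sup_idem _).symm
    | exact (inf_idem _).symm
    | exact sup_sup_distrib_right x y z
    | exact inf_inf_distrib_right x y z
    | exact sup_inf_right x y z
    | exact inf_sup_right x y z

/-- The four-term homology `H_n(L)` of a distributive lattice with integer coefficients and
scalars `(a, b, c, d)` weighting left projection, join, meet and right projection. -/
noncomputable abbrev fourTermHomology (L : Type*) [DistribLattice L] (a b c d : ℤ) (n : ℕ) :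
    ModuleCat ℤ :=
  (chainComplex (latticeOps L) (isDistributive_latticeOps L) ![a, b, c, d]).homology n

/-- The augmented four-term homology of a distributive lattice in degree `n`, with integer
coefficients and scalars `(a, b, c, d)`. -/
noncomputable abbrev augmentedFourTermHomology (L : Type*) [DistribLattice L] (a b c d : ℤ)
    (n : ℕ) : ModuleCat ℤ :=
  (augmentedChainComplex (latticeOps L) (isDistributive_latticeOps L)
    ![a, b, c, d]).homology (n + 1)

/-- The Kronecker delta `δ_{0,n}`. -/
def delta (n : ℕ) : ℕ := if n = 0 then 1 else 0

end DistributiveHomology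

/-! Appending a fixed `y` to tuples is a homotopy: all faces but the last commute with it, and the
last one applies `· ⋆_r y` to each entry. Hence `∑ a_r (· ⋆_r y)` kills augmented homology
(`rightAction_mem_boundaries`). For `y = ⊤` this operator is `(a + c) id` plus `b` times the
constant map to `⊤`; for `y = ⊥` it is `(a + b) id` plus `c` times the constant map to `⊥`.

Unless `b = c = -a`, one of `a + b`, `a + c` is nonzero, so up to torsion the augmented homology is
spanned by the constant tuple at `y`. Parity and the value of `a + b + c` decide whether that tuple
contributes.

If `b = c = -a ≠ 0`, scale to `(1, -1, -1, 0)`. On the two-element lattice the differential is then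
minus that of the right projection, whose cycles split as `ker tailMap`, of rank `2 ^ n`, plus
boundaries. On a power set the homotopy reads `z ∼ z ∨ y + z ∧ y`. Together with the same relation
for the complement of `y`, it gives `z ∼ z ∧ y + z ∧ yᶜ`, hence `z ∼ ∑ j, z ∧ {j}`. So the augmented
homology is one copy of the two-element answer for each point of `A` (`augCycles_powerSet`). -/

namespace DistributiveHomology

/-! ### Ranks of homology modules over a domain. -/

section Homology

universe u

/-- Rank-nullity for the homology of a short complex of modules over a domain. -/
theorem rank_homology_add_rank_range {R : Type*} [CommRing R] [IsDomain R]
    (S : ShortComplex (ModuleCat.{u} R)) :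
    Module.rank R S.homology + Module.rank R (LinearMap.range S.f.hom) =
      Module.rank R (LinearMap.ker S.g.hom) := by
  have h₁ : Module.rank R S.homology =
      Module.rank R (LinearMap.ker S.g.hom ⧸ LinearMap.range S.moduleCatToCycles) :=
    S.moduleCatHomologyIso.toLinearEquiv.rank_eq
  have h₂ : Module.rank R (LinearMap.range S.f.hom) =
      Module.rank R (LinearMap.range S.moduleCatToCycles) := by
    have : LinearMap.range S.f.hom =
        (LinearMap.range S.moduleCatToCycles).map (LinearMap.ker S.g.hom).subtype := by
      rw [← LinearMap.range_comp]; rfl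
    rw [this]
    exact (Submodule.equivMapOfInjective _ (Submodule.injective_subtype _) _).rank_eq.symm
  rw [h₁, h₂, Submodule.rank_quotient_add_rank]

theorem rank_chainComplex_homology_add {R : Type*} [CommRing R] [IsDomain R]
    (K : ChainComplex (ModuleCat.{u} R) ℕ) {i j k : ℕ} (hi : j + 1 = i)
    (hk : (ComplexShape.down ℕ).next j = k) :
    Module.rank R (K.homology j) + Module.rank R (LinearMap.range (K.d i j).hom) =
      Module.rank R (LinearMap.ker (K.d j k).hom) := by
  have h := rank_homology_add_rank_range (K.sc' i j k)
  rwa [← (K.homologyIsoSc' i j k (by simp [← hi]) hk).toLinearEquiv.rank_eq] at h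

end Homology

/-! ### Homology ranks as differences of ranks of cycles and boundaries. -/

section Betti

variable {R X : Type*} [CommRing R] {k : ℕ}

/-- Cycles of the augmented multi-term complex. -/
noncomputable def augCycles (ops : Fin k → X → X → X) (a : Fin k → R) :
    ∀ n : ℕ, Submodule R (Chain R X n)
  | 0 => LinearMap.ker (augmentation R X)
  | n + 1 => LinearMap.ker (differential ops a n)

/-- Boundaries of the multi-term complex. -/
noncomputable def boundaries (ops : Fin k → X → X → X) (a : Fin k → R) (n : ℕ) :
    Submodule R (Chain R X n) :=
  LinearMap.range (differential ops a n)

theorem boundaries_le_augCycles {ops : Fin k → X → X → X} (h : IsDistributive ops)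
    (a : Fin k → R) : ∀ n, boundaries ops a n ≤ augCycles ops a n
  | 0 => by
    rintro _ ⟨x, rfl⟩
    exact LinearMap.congr_fun (augmentation_comp ops a) x
  | n + 1 => by
    rintro _ ⟨x, rfl⟩
    exact LinearMap.congr_fun (differential_comp h a n) x

theorem augmentation_surjective [Nonempty X] : Function.Surjective (augmentation R X) := fun r =>
  ⟨Finsupp.single (fun _ => Classical.arbitrary X) r, by simp [augmentation]⟩

/-- The rank of the augmented homology. -/
noncomputable def reducedBetti (ops : Fin k → X → X → X) (a : Fin k → R) (n : ℕ) : ℕ :=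
  Module.finrank R (augCycles ops a n) - Module.finrank R (boundaries ops a n)

theorem chainComplex_d {ops : Fin k → X → X → X} (h : IsDistributive ops) (a : Fin k → R)
    (n : ℕ) : (chainComplex ops h a).d (n + 1) n = ModuleCat.ofHom (differential ops a n) :=
  ChainComplex.of_d (fun n => ModuleCat.of R (Chain R X n))
    (fun n => ModuleCat.ofHom (differential ops a n)) n

theorem finrank_ker_augmentation_add_one [IsDomain R] [Finite X] [Nonempty X] :
    Module.finrank R (LinearMap.ker (augmentation R X)) + 1 = Module.finrank R (Chain R X 0) := by
  rw [← Submodule.finrank_quotient_add_finrank (LinearMap.ker (augmentation R X)),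
    ((augmentation R X).quotKerEquivOfSurjective augmentation_surjective).finrank_eq,
    Module.finrank_self, add_comm]

variable [IsDomain R] [IsNoetherianRing R] [Finite X]

theorem reducedBetti_add {ops : Fin k → X → X → X} (h : IsDistributive ops) (a : Fin k → R)
    (n : ℕ) : reducedBetti ops a n + Module.finrank R (boundaries ops a n) =
      Module.finrank R (augCycles ops a n) :=
  Nat.sub_add_cancel (Submodule.finrank_mono (boundaries_le_augCycles h a n))

theorem rank_eq_of_add_eq {M : Type*} [AddCommGroup M] [Module R M] [Module.Finite R M]
    {N P : Submodule R M} {m : ℕ} {r : Cardinal} (h : r + Module.rank R N = Module.rank R P)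
    (hm : m + Module.finrank R N = Module.finrank R P) : r = m := by
  rw [← Module.finrank_eq_rank, ← Module.finrank_eq_rank, ← hm, Nat.cast_add] at h
  exact Cardinal.eq_of_add_eq_add_right h (Cardinal.natCast_lt_aleph0)

theorem rank_augmentedHomology {ops : Fin k → X → X → X} (h : IsDistributive ops)
    (a : Fin k → R) (n : ℕ) :
    Module.rank R ((augmentedChainComplex ops h a).homology (n + 1)) = reducedBetti ops a n := by
  have key := rank_chainComplex_homology_add (augmentedChainComplex ops h a)
    (i := n + 2) (j := n + 1) (k := n) rfl (by simp)
  have hd : (augmentedChainComplex ops h a).d (n + 2) (n + 1) =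
      ModuleCat.ofHom (differential ops a n) := chainComplex_d h a n
  have hk : LinearMap.ker ((augmentedChainComplex ops h a).d (n + 1) n).hom =
      augCycles ops a n := by
    cases n with
    | zero => exact LinearEquiv.ker_comp _ _
    | succ n =>
      change LinearMap.ker ((chainComplex ops h a).d (n + 1) n).hom = _
      rw [chainComplex_d]; rfl
  rw [hk, hd] at key
  refine rank_eq_of_add_eq (M := Chain R X n) ?_ (reducedBetti_add h a n)
  exact key

theorem rank_homology [Nonempty X] {ops : Fin k → X → X → X} (h : IsDistributive ops)
    (a : Fin k → R) (n : ℕ) :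
    Module.rank R ((chainComplex ops h a).homology n) =
      ((reducedBetti ops a n + delta n : ℕ) : Cardinal) := by
  cases n with
  | zero =>
    -- Index 0 has no successor in `ComplexShape.down ℕ`, so `next 0` defaults to 0 and the outgoing
    -- map is zero. Every 0-chain is a cycle, one rank more than the kernel of the augmentation;
    -- this is the source of `delta`.
    have key := rank_chainComplex_homology_add (chainComplex ops h a)
      (i := 1) (j := 0) (k := 0) rfl (by simp)
    rw [chainComplex_d, (chainComplex ops h a).shape 0 0 (by simp)] at key
    have hk : LinearMap.ker (0 : (chainComplex ops h a).X 0 ⟶ (chainComplex ops h a).X 0).hom =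
        (⊤ : Submodule R (Chain R X 0)) := LinearMap.ker_zero
    rw [hk] at key
    refine rank_eq_of_add_eq (M := Chain R X 0) (N := boundaries ops a 0) (P := ⊤) key ?_
    have h₁ := reducedBetti_add h a 0
    have h₂ := finrank_ker_augmentation_add_one (R := R) (X := X)
    change _ = Module.finrank R (LinearMap.ker (augmentation R X)) at h₁
    change _ + Module.finrank R (boundaries ops a 0) = _
    rw [finrank_top, ← h₂, ← h₁, delta, if_pos rfl]
    ring
  | succ n =>
    have key := rank_chainComplex_homology_add (chainComplex ops h a)
      (i := n + 2) (j := n + 1) (k := n) rfl (by simp)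
    rw [chainComplex_d, chainComplex_d] at key
    refine rank_eq_of_add_eq (M := Chain R X (n + 1)) ?_ (reducedBetti_add h a (n + 1))
    exact key

end Betti

/-! ### The homotopy that appends an element. -/

section Homotopy

variable {R X : Type*} [CommRing R] {k : ℕ}

/-- Appending `y` at the end of a tuple, on chains. -/
noncomputable def appendMap (R : Type*) {X : Type*} [CommRing R] (y : X) (n : ℕ) :
    Chain R X n →ₗ[R] Chain R X (n + 1) :=
  Finsupp.lmapDomain R R fun x => (Fin.snoc x y : Fin (n + 2) → X)

/-- The chain map induced by a map of sets. -/
noncomputable def chainMap (R : Type*) {X Y : Type*} [CommRing R] (f : X → Y) (n : ℕ) :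
    Chain R X n →ₗ[R] Chain R Y n :=
  Finsupp.lmapDomain R R fun x => f ∘ x

/-- The combination `∑_r a_r (· ⋆_r y)` of chain maps. -/
noncomputable def rightAction (ops : Fin k → X → X → X) (a : Fin k → R) (y : X) (n : ℕ) :
    Chain R X n →ₗ[R] Chain R X n :=
  ∑ r : Fin k, a r • chainMap R (fun x => ops r x y) n

theorem face_castSucc_snoc (op : X → X → X) {n : ℕ} (i : Fin (n + 2)) (x : Fin (n + 2) → X)
    (y : X) : face op i.castSucc (Fin.snoc x y : Fin (n + 3) → X) =
      (Fin.snoc (face op i x) y : Fin (n + 2) → X) := by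
  funext m
  refine Fin.lastCases ?_ (fun m => ?_) m
  · have : ¬ Fin.last (n + 1) < i := not_lt.mpr (Fin.le_last i)
    simp [face, this]
  · simp [face, ← Fin.castSucc_succ]

theorem face_last_snoc (op : X → X → X) {n : ℕ} (x : Fin (n + 1) → X) (y : X) :
    face op (Fin.last (n + 1)) (Fin.snoc x y : Fin (n + 2) → X) = fun m => op (x m) y := by
  funext m
  simp [face, Fin.castSucc_lt_last]

theorem face_zero (op : X → X → X) {n : ℕ} (x : Fin (n + 2) → X) :
    face op 0 x = Fin.tail x := by
  funext m
  simp [face, Fin.tail]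

theorem multiFace_castSucc_append (ops : Fin k → X → X → X) (a : Fin k → R) (y : X) {n : ℕ}
    (i : Fin (n + 2)) : multiFace ops a i.castSucc ∘ₗ appendMap R y (n + 1) =
      appendMap R y n ∘ₗ multiFace ops a i := by
  refine Finsupp.lhom_ext fun x c => ?_
  simp [multiFace, appendMap, map_sum, Finsupp.mapDomain_single,
    face_castSucc_snoc, -Finsupp.smul_single]

theorem multiFace_last_append (ops : Fin k → X → X → X) (a : Fin k → R) (y : X) (n : ℕ) :
    multiFace ops a (Fin.last (n + 1)) ∘ₗ appendMap R y n = rightAction ops a y n := by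
  refine Finsupp.lhom_ext fun x c => ?_
  simp [multiFace, appendMap, rightAction, chainMap, LinearMap.sum_apply,
    Finsupp.mapDomain_single, face_last_snoc, -Finsupp.smul_single, Function.comp_def]

theorem differential_append (ops : Fin k → X → X → X) (a : Fin k → R) (y : X) (n : ℕ) :
    differential ops a (n + 1) ∘ₗ appendMap R y (n + 1) =
      appendMap R y n ∘ₗ differential ops a n +
        (-1 : R) ^ (n + 2) • rightAction ops a y (n + 1) := by
  rw [differential_eq, differential_eq, Fin.sum_univ_castSucc, LinearMap.add_comp,
    LinearMap.smul_comp, multiFace_last_append]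
  congr 1
  refine LinearMap.ext fun z => ?_
  have h := fun i => LinearMap.congr_fun (multiFace_castSucc_append ops a y (n := n) i) z
  simp only [LinearMap.comp_apply] at h
  simp only [LinearMap.comp_apply, LinearMap.sum_apply, LinearMap.smul_apply, map_sum, map_smul,
    h, Fin.val_castSucc]

/-- The degree 0 defect of the homotopy: `d_0 (x, y) = (y)` forgets `x`, so it vanishes only on
chains of augmentation zero. -/
theorem multiFace_zero_append (ops : Fin k → X → X → X) (a : Fin k → R) (y : X) :
    multiFace ops a 0 ∘ₗ appendMap R y 0 =
      (∑ r, a r) • (Finsupp.lsingle fun _ => y) ∘ₗ augmentation R X := by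
  refine Finsupp.lhom_ext fun x c => ?_
  have : ∀ x : Fin 1 → X, (Fin.tail (Fin.snoc x y : Fin 2 → X) : Fin 1 → X) = fun _ => y := by
    intro x
    funext m
    fin_cases m
    exact Fin.snoc_last _ _
  simp [multiFace, appendMap, augmentation, LinearMap.sum_apply, Finsupp.mapDomain_single,
    face_zero, -Finsupp.smul_single, this, Finset.sum_smul]

/-- The homotopy `x ↦ (x, y)` shows that `∑_r a_r (· ⋆_r y)` kills augmented homology. -/
theorem rightAction_mem_boundaries (ops : Fin k → X → X → X) (a : Fin k → R) (y : X) :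
    ∀ {n : ℕ} {z : Chain R X n}, z ∈ augCycles ops a n →
      rightAction ops a y n z ∈ boundaries ops a n
  | 0, z, hz => by
    refine ⟨-appendMap R y 0 z, ?_⟩
    have h₁ := LinearMap.congr_fun (multiFace_last_append ops a y 0) z
    have h₂ := LinearMap.congr_fun (multiFace_zero_append ops a y) z
    have hz' : augmentation R X z = 0 := hz
    simp only [LinearMap.comp_apply, LinearMap.smul_apply, hz', map_zero, smul_zero] at h₁ h₂
    have h₁' : multiFace ops a 1 (appendMap R y 0 z) = _ := h₁
    rw [differential_eq]
    simp [Fin.sum_univ_succ, h₁', h₂]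
  | n + 1, z, hz => by
    refine ⟨(-1 : R) ^ (n + 2) • appendMap R y (n + 1) z, ?_⟩
    have h₁ := LinearMap.congr_fun (differential_append ops a y n) z
    have hz' : differential ops a n z = 0 := hz
    simp only [LinearMap.comp_apply, LinearMap.add_apply, LinearMap.smul_apply, hz', map_zero,
      zero_add] at h₁
    rw [map_smul, h₁, smul_smul, ← mul_pow]
    simp

end Homotopy

/-! ### Chain maps induced by homomorphisms. -/

section Functoriality

variable {R X Y : Type*} [CommRing R] {k : ℕ} {opsX : Fin k → X → X → X}
  {opsY : Fin k → Y → Y → Y} {f : X → Y}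

theorem chainMap_comp_differential (hf : ∀ r x y, f (opsX r x y) = opsY r (f x) (f y))
    (a : Fin k → R) (n : ℕ) : chainMap R f n ∘ₗ differential opsX a n =
      differential opsY a n ∘ₗ chainMap R f (n + 1) := by
  have hface : ∀ r (i : Fin (n + 2)) x, f ∘ face (opsX r) i x = face (opsY r) i (f ∘ x) := by
    intro r i x
    funext m
    simp only [face, Function.comp_apply]
    split_ifs <;> simp [hf]
  refine Finsupp.lhom_ext fun x c => ?_
  simp [differential, oneTermDifferential, chainMap, map_sum,
    Finsupp.mapDomain_single, hface, -Finsupp.smul_single]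

theorem augmentation_chainMap (f : X → Y) :
    augmentation R Y ∘ₗ chainMap R f 0 = augmentation R X := by
  refine Finsupp.lhom_ext fun x c => ?_
  simp [augmentation, chainMap, Finsupp.mapDomain_single]

theorem chainMap_mem_boundaries (hf : ∀ r x y, f (opsX r x y) = opsY r (f x) (f y))
    (a : Fin k → R) {n : ℕ} {z : Chain R X n} (hz : z ∈ boundaries opsX a n) :
    chainMap R f n z ∈ boundaries opsY a n := by
  obtain ⟨w, rfl⟩ := hz
  exact ⟨_, (LinearMap.congr_fun (chainMap_comp_differential hf a n) w).symm⟩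

theorem chainMap_mem_augCycles (hf : ∀ r x y, f (opsX r x y) = opsY r (f x) (f y))
    (a : Fin k → R) : ∀ {n : ℕ} {z : Chain R X n}, z ∈ augCycles opsX a n →
      chainMap R f n z ∈ augCycles opsY a n
  | 0, z, hz => (LinearMap.congr_fun (augmentation_chainMap f) z).trans hz
  | n + 1, z, hz => by
    have hz' : differential opsX a n z = 0 := hz
    change differential opsY a n _ = 0
    have := LinearMap.congr_fun (chainMap_comp_differential hf a n) z
    rw [LinearMap.comp_apply, LinearMap.comp_apply, hz', map_zero] at this
    exact this.symm

theorem chainMap_chainMap {Z : Type*} (g : Y → Z) (f : X → Y) (n : ℕ) (z : Chain R X n) :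
    chainMap R g n (chainMap R f n z) = chainMap R (g ∘ f) n z :=
  (LinearMap.congr_fun (Finsupp.lmapDomain_comp R R (fun x : Fin (n + 1) → X => f ∘ x)
    (fun x : Fin (n + 1) → Y => g ∘ x)) z).symm

theorem chainMap_id (n : ℕ) (z : Chain R X n) : chainMap R id n z = z :=
  LinearMap.congr_fun (Finsupp.lmapDomain_id R R) z

end Functoriality

/-! ### Rank comparisons. -/

section Rank

variable {R M : Type*} [CommRing R] [IsDomain R] [IsNoetherianRing R] [AddCommGroup M]
  [Module R M] [Module.Finite R M]

/-- Multiplication by `r` embeds `P` in `N`. This plays the role of passing to the fraction field: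
relations need only hold up to a nonzero factor. -/
theorem finrank_le_of_smul_mem [Module.IsTorsionFree R M] {N P : Submodule R M} {r : R}
    (hr : r ≠ 0) (h : ∀ z ∈ P, r • z ∈ N) : Module.finrank R P ≤ Module.finrank R N :=
  LinearMap.finrank_le_finrank_of_injective
    (f := ((LinearMap.lsmul R M r).restrict h : P →ₗ[R] N)) fun _ _ hxy =>
      Subtype.ext (smul_right_injective M hr (congrArg Subtype.val hxy))

theorem finrank_sup_of_disjoint {N P : Submodule R M} (h : Disjoint N P) :
    Module.finrank R (N ⊔ P : Submodule R M) = Module.finrank R N + Module.finrank R P := by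
  have key := Submodule.rank_sup_add_rank_inf_eq N P
  rw [h.eq_bot, rank_bot, add_zero, ← Module.finrank_eq_rank, ← Module.finrank_eq_rank,
    ← Module.finrank_eq_rank] at key
  exact_mod_cast key

end Rank

/-! ### Homology when some right action is a nonzero scalar plus a constant map. -/

section Contraction

variable {R X : Type*} [CommRing R] {k : ℕ}

/-- The sum of the coefficients of a chain. -/
noncomputable def coeffSum (R X : Type*) [CommRing R] (n : ℕ) : Chain R X n →ₗ[R] R :=
  Finsupp.linearCombination R fun _ => (1 : R)

theorem coeffSum_differential (ops : Fin k → X → X → X) (a : Fin k → R) (n : ℕ) :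
    coeffSum R X n ∘ₗ differential ops a n =
      ((∑ r, a r) * if Even n then 0 else 1) • coeffSum R X (n + 1) := by
  have hs : ∑ i : Fin (n + 2), (-1 : R) ^ (i : ℕ) = if Even n then 0 else 1 := by
    rw [Fin.sum_neg_one_pow]
    simp [Nat.even_add]
  refine Finsupp.lhom_ext fun x c => ?_
  rw [← hs]
  simp only [coeffSum, differential, oneTermDifferential, LinearMap.comp_apply,
    LinearMap.sum_apply, LinearMap.smul_apply, map_sum, map_smul, Finsupp.lmapDomain_apply,
    Finsupp.mapDomain_single, Finsupp.linearCombination_single, smul_eq_mul, mul_one,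
    ← Finset.sum_mul]
  ring

theorem differential_const {ops : Fin k → X → X → X} (a : Fin k → R) {y : X}
    (hy : ∀ r, ops r y y = y) (n : ℕ) :
    differential ops a n (Finsupp.single (fun _ => y) 1) =
      ((∑ r, a r) * if Even n then 0 else 1) • Finsupp.single (fun _ => y) 1 := by
  have hs : ∑ i : Fin (n + 2), (-1 : R) ^ (i : ℕ) = if Even n then 0 else 1 := by
    rw [Fin.sum_neg_one_pow]
    simp [Nat.even_add]
  have hface : ∀ r (i : Fin (n + 2)), face (ops r) i (fun _ => y) = fun _ => y := by
    intro r i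
    funext m
    simp [face, hy]
  rw [← hs]
  simp only [differential, oneTermDifferential, LinearMap.sum_apply, LinearMap.smul_apply,
    Finsupp.lmapDomain_apply, Finsupp.mapDomain_single, hface, ← Finset.sum_smul, smul_smul,
    ← Finset.sum_mul]

variable {ops : Fin k → X → X → X} {a : Fin k → R} {y : X} {c m : R}

theorem smul_add_mem_boundaries
    (hact : ∀ n z, rightAction ops a y n z =
      c • z + (m * coeffSum R X n z) • Finsupp.single (fun _ => y) 1)
    {n : ℕ} {z : Chain R X n} (hz : z ∈ augCycles ops a n) :
    c • z + (m * coeffSum R X n z) • Finsupp.single (fun _ => y) 1 ∈ boundaries ops a n :=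
  hact n z ▸ rightAction_mem_boundaries ops a y hz

/-- The constant tuple's term is removed by parity. In odd degree `∑ a_r` times the constant tuple
is the boundary of the next constant tuple. In even positive degree, applying `coeffSum` to `∂z = 0`
gives `(∑ a_r) * coeffSum z = 0`; in degree 0 the augmentation gives `coeffSum z = 0`. -/
theorem sum_smul_smul_mem_boundaries (hy : ∀ r, ops r y y = y)
    (hact : ∀ n z, rightAction ops a y n z =
      c • z + (m * coeffSum R X n z) • Finsupp.single (fun _ => y) 1)
    {n : ℕ} {z : Chain R X n} (hz : z ∈ augCycles ops a n) :
    ((∑ r, a r) * c) • z ∈ boundaries ops a n := by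
  have h₁ := (boundaries ops a n).smul_mem (∑ r, a r) (smul_add_mem_boundaries hact hz)
  have h₂ : ((∑ r, a r) * (m * coeffSum R X n z)) • Finsupp.single (fun _ => y) (1 : R) ∈
      boundaries ops a n := by
    by_cases hn : Even n
    · have : (∑ r, a r) * coeffSum R X n z = 0 ∨ coeffSum R X n z = 0 := by
        cases n with
        | zero => exact Or.inr hz
        | succ n =>
          left
          have hz' : differential ops a n z = 0 := hz
          have := LinearMap.congr_fun (coeffSum_differential ops a n) z
          rw [LinearMap.comp_apply, hz', map_zero, if_neg (by grind), mul_one] at this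
          exact this.symm
      rcases this with h | h
      · rw [mul_left_comm, h, mul_zero, zero_smul]; exact zero_mem _
      · rw [h, mul_zero, mul_zero, zero_smul]; exact zero_mem _
    · refine ⟨(m * coeffSum R X n z) • Finsupp.single (fun _ => y) 1, ?_⟩
      rw [map_smul, differential_const a hy, if_neg hn, mul_one, smul_smul, mul_comm]
  rw [smul_add, smul_smul, smul_smul] at h₁
  exact (Submodule.add_mem_iff_left _ h₂).mp h₁

variable [IsDomain R] [IsNoetherianRing R] [Finite X]

theorem reducedBetti_eq_zero_of_contraction (hy : ∀ r, ops r y y = y)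
    (hact : ∀ n z, rightAction ops a y n z =
      c • z + (m * coeffSum R X n z) • Finsupp.single (fun _ => y) 1)
    (hc : c ≠ 0) (hs : ∑ r, a r ≠ 0) (n : ℕ) : reducedBetti ops a n = 0 :=
  Nat.sub_eq_zero_of_le (finrank_le_of_smul_mem (mul_ne_zero hs hc)
    fun _ hz => sum_smul_smul_mem_boundaries hy hact hz)

theorem reducedBetti_zero_eq_zero_of_contraction
    (hact : ∀ n z, rightAction ops a y n z =
      c • z + (m * coeffSum R X n z) • Finsupp.single (fun _ => y) 1)
    (hc : c ≠ 0) : reducedBetti ops a 0 = 0 := by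
  refine Nat.sub_eq_zero_of_le (finrank_le_of_smul_mem hc fun z hz => ?_)
  have h := smul_add_mem_boundaries hact hz
  -- In degree 0 `coeffSum` is the augmentation by definition.
  have hz' : coeffSum R X 0 z = 0 := hz
  rwa [hz', mul_zero, zero_smul, add_zero] at h

theorem reducedBetti_succ_eq_one_of_contraction (h : IsDistributive ops)
    (hy : ∀ r, ops r y y = y)
    (hact : ∀ n z, rightAction ops a y n z =
      c • z + (m * coeffSum R X n z) • Finsupp.single (fun _ => y) 1)
    (hc : c ≠ 0) (hs : ∑ r, a r = 0) (n : ℕ) : reducedBetti ops a (n + 1) = 1 := by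
  set e : Chain R X (n + 1) := Finsupp.single (fun _ => y) 1
  have he : coeffSum R X (n + 1) e = 1 := by simp [coeffSum, e]
  have he' : e ≠ 0 := by simp [e]
  have heZ : e ∈ augCycles ops a (n + 1) := by
    change differential ops a n e = 0
    rw [differential_const a hy, hs, zero_mul, zero_smul]
  -- With `∑ a_r = 0`, `coeffSum` kills all boundaries but takes the value 1 on `e`.
  have hdisj : Disjoint (R ∙ e) (boundaries ops a (n + 1)) := by
    rw [Submodule.disjoint_def]
    rintro x hx ⟨w, rfl⟩
    obtain ⟨t, ht⟩ := Submodule.mem_span_singleton.mp hx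
    have := LinearMap.congr_fun (coeffSum_differential ops a (n + 1)) w
    rw [LinearMap.comp_apply, hs, zero_mul, zero_smul, ← ht, map_smul, he] at this
    have ht0 : t = 0 := by simpa using this
    rw [← ht, ht0, zero_smul]
  have hle : (R ∙ e) ⊔ boundaries ops a (n + 1) ≤ augCycles ops a (n + 1) :=
    sup_le ((Submodule.span_singleton_le_iff_mem _ _).mpr heZ) (boundaries_le_augCycles h a _)
  have hrank : Module.finrank R (augCycles ops a (n + 1)) =
      1 + Module.finrank R (boundaries ops a (n + 1)) := by
    have h₁ := finrank_sup_of_disjoint hdisj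
    rw [← (LinearEquiv.toSpanNonzeroSingleton R _ e he').finrank_eq, Module.finrank_self] at h₁
    rw [← h₁]
    refine le_antisymm (finrank_le_of_smul_mem hc fun z hz => ?_) (Submodule.finrank_mono hle)
    have h₂ := smul_add_mem_boundaries hact hz
    refine (Submodule.add_mem_iff_left _ ?_).mp (Submodule.mem_sup_right h₂)
    exact Submodule.mem_sup_left (Submodule.smul_mem _ _ (Submodule.mem_span_singleton_self e))
  rw [reducedBetti, hrank, Nat.add_sub_cancel]

end Contraction

/-! ### Contractions at the top and bottom of a bounded distributive lattice. -/

section Lattice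

variable {L : Type*} [DistribLattice L]

theorem chainMap_const {R X Y : Type*} [CommRing R] (y : Y) (n : ℕ) (z : Chain R X n) :
    chainMap R (fun _ : X => y) n z = coeffSum R X n z • Finsupp.single (fun _ => y) 1 := by
  have : chainMap R (fun _ : X => y) n =
      (coeffSum R X n).smulRight (Finsupp.single (fun _ => y) (1 : R)) := by
    refine Finsupp.lhom_ext fun x c => ?_
    simp [chainMap, coeffSum, Finsupp.mapDomain_single, Function.comp_def]
  rw [this, LinearMap.smulRight_apply]

theorem rightAction_latticeOps (a b c : ℤ) (y : L) (n : ℕ) (z : Chain ℤ L n) :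
    rightAction (latticeOps L) ![a, b, c, 0] y n z =
      a • z + b • chainMap ℤ (· ⊔ y) n z + c • chainMap ℤ (· ⊓ y) n z := by
  have h := chainMap_id (R := ℤ) n z
  simp only [rightAction, Fin.sum_univ_four, latticeOps, Matrix.cons_val, LinearMap.add_apply,
    LinearMap.smul_apply, zero_smul, add_zero]
  congr 3

theorem rightAction_top [OrderTop L] (a b c : ℤ) (n : ℕ) (z : Chain ℤ L n) :
    rightAction (latticeOps L) ![a, b, c, 0] ⊤ n z =
      (a + c) • z + (b * coeffSum ℤ L n z) • Finsupp.single (fun _ => ⊤) 1 := by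
  have h := chainMap_id (R := ℤ) n z
  rw [rightAction_latticeOps]
  simp only [sup_top_eq, inf_top_eq, chainMap_const]
  rw [show chainMap ℤ (fun x : L => x) n z = z from h]
  module

theorem rightAction_bot [OrderBot L] (a b c : ℤ) (n : ℕ) (z : Chain ℤ L n) :
    rightAction (latticeOps L) ![a, b, c, 0] ⊥ n z =
      (a + b) • z + (c * coeffSum ℤ L n z) • Finsupp.single (fun _ => ⊥) 1 := by
  have h := chainMap_id (R := ℤ) n z
  rw [rightAction_latticeOps]
  simp only [sup_bot_eq, inf_bot_eq, chainMap_const]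
  rw [show chainMap ℤ (fun x : L => x) n z = z from h]
  module

theorem latticeOps_self (r : Fin 4) (y : L) : latticeOps L r y y = y := by
  fin_cases r <;> simp [latticeOps]

theorem exists_contraction [BoundedOrder L] {a b c : ℤ} (h : ¬ (b = -a ∧ c = -a)) :
    ∃ (y : L) (r m : ℤ), r ≠ 0 ∧ ∀ n z, rightAction (latticeOps L) ![a, b, c, 0] y n z =
      r • z + (m * coeffSum ℤ L n z) • Finsupp.single (fun _ => y) 1 := by
  -- If `a + b` and `a + c` both vanished, the scalars would be the excluded ones; so `⊤` works
  -- whenever `⊥` does not.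
  by_cases hb : a + b = 0
  · exact ⟨⊤, a + c, b, by grind, rightAction_top a b c⟩
  · exact ⟨⊥, a + b, c, hb, rightAction_bot a b c⟩

variable [BoundedOrder L] [Finite L] {a b c : ℤ}

theorem reducedBetti_latticeOps_eq_zero (h : ¬ (b = -a ∧ c = -a)) (hs : a + b + c ≠ 0) (n : ℕ) :
    reducedBetti (latticeOps L) ![a, b, c, 0] n = 0 := by
  obtain ⟨y, r, m, hr, hact⟩ := exists_contraction (L := L) h
  exact reducedBetti_eq_zero_of_contraction (fun r => latticeOps_self r y) hact hr
    (by simpa [Fin.sum_univ_four] using hs) n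

theorem reducedBetti_latticeOps_add_delta (h : ¬ (b = -a ∧ c = -a)) (hs : a + b + c = 0) (n : ℕ) :
    reducedBetti (latticeOps L) ![a, b, c, 0] n + delta n = 1 := by
  obtain ⟨y, r, m, hr, hact⟩ := exists_contraction (L := L) h
  cases n with
  | zero => rw [reducedBetti_zero_eq_zero_of_contraction hact hr, delta, if_pos rfl]
  | succ n =>
    rw [reducedBetti_succ_eq_one_of_contraction (isDistributive_latticeOps L)
      (fun r => latticeOps_self r y) hact hr (by simpa [Fin.sum_univ_four] using hs), delta,
      if_neg n.succ_ne_zero]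

end Lattice

/-! ### The complex of the right projection. -/

section RightProjection

variable {R X : Type*} [CommRing R]

/-- Forgetting the first entry of a tuple, on chains. -/
noncomputable def tailMap (R X : Type*) [CommRing R] (n : ℕ) :
    Chain R X n →ₗ[R] ((Fin n → X) →₀ R) :=
  Finsupp.lmapDomain R R fun x : Fin (n + 1) → X => Fin.tail x

/-- The one-term differential of the right projection. -/
noncomputable abbrev rightDifferential (R X : Type*) [CommRing R] (n : ℕ) :
    Chain R X (n + 1) →ₗ[R] Chain R X n :=
  oneTermDifferential R (fun _ y : X => y) n

theorem face_right_cons_tail {n : ℕ} (i : Fin (n + 2)) (x : Fin (n + 2) → X) (w : X) :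
    face (fun _ y => y) i (Fin.cons w (Fin.tail x) : Fin (n + 2) → X) =
      face (fun _ y => y) i x := by
  funext m
  refine Fin.cases ?_ (fun i => ?_) i <;> simp [face, Fin.tail]

/-- No face `(x_i, …, x_i, x_{i+1}, …)` depends on `x_0`, so the differential factors through
`tailMap`. -/
theorem ker_tailMap_le [Nonempty X] (n : ℕ) :
    LinearMap.ker (tailMap R X (n + 1)) ≤ LinearMap.ker (rightDifferential R X n) := by
  have : rightDifferential R X n = (rightDifferential R X n ∘ₗ Finsupp.lmapDomain R R
      fun t : Fin (n + 1) → X => (Fin.cons (Classical.arbitrary X) t : Fin (n + 2) → X)) ∘ₗ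
        tailMap R X (n + 1) := by
    refine Finsupp.lhom_ext fun x c => ?_
    simp [oneTermDifferential, tailMap, Finsupp.mapDomain_single, face_right_cons_tail]
  rw [this]
  exact LinearMap.ker_le_ker_comp _ _

theorem tail_face_right_cons {n : ℕ} (i : Fin (n + 2)) (x : Fin (n + 2) → X) :
    Fin.tail (face (fun _ y => y) i.succ
      (Fin.cons (x 0) (Fin.cons (x 1) (Fin.tail x)) : Fin (n + 3) → X)) =
      face (fun _ y => y) i x := by
  funext m
  refine Fin.cases ?_ (fun i => ?_) i <;> simp [face, Fin.tail]

/-- Doubling `x_1` gives `(x_0, x_1, x_1, x_2, …)`. After dropping first entries, its face 0 is the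
tail of `x` and its face `i + 1` is face `i` of `x`, with opposite sign. For a cycle `z`, this
yields a boundary with the same tail as `z`. -/
theorem tailMap_comp_rightDifferential (n : ℕ) :
    tailMap R X (n + 1) ∘ₗ rightDifferential R X (n + 1) ∘ₗ (Finsupp.lmapDomain R R
      fun x : Fin (n + 2) → X =>
        (Fin.cons (x 0) (Fin.cons (x 1) (Fin.tail x)) : Fin (n + 3) → X)) =
      tailMap R X (n + 1) - rightDifferential R X n := by
  refine Finsupp.lhom_ext fun x c => ?_
  simp only [oneTermDifferential, tailMap, LinearMap.comp_apply, LinearMap.sub_apply,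
    LinearMap.sum_apply, LinearMap.smul_apply, map_sum, map_smul, Finsupp.lmapDomain_apply,
    Finsupp.mapDomain_single]
  rw [Fin.sum_univ_succ]
  simp only [tail_face_right_cons, Fin.val_zero, pow_zero, one_smul, face_zero, Fin.val_succ,
    pow_succ, mul_neg, mul_one, neg_smul, Finset.sum_neg_distrib, Fin.tail_cons,
    ← sub_eq_add_neg]

/-- Faces 0 and 1 coincide and cancel. -/
theorem rightDifferential_eq (n : ℕ) : rightDifferential R X n =
    ∑ i : Fin n, (-1 : R) ^ (i : ℕ) •
      Finsupp.lmapDomain R R (face (fun _ y : X => y) i.succ.succ) := by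
  have h : face (n := n) (fun _ y : X => y) 1 = face (fun _ y : X => y) 0 := by
    funext x m
    refine Fin.cases ?_ (fun m => ?_) m <;> simp [face]
  rw [rightDifferential, oneTermDifferential, Fin.sum_univ_succ, Fin.sum_univ_succ]
  refine LinearMap.ext fun z => ?_
  simp [h, pow_succ]

theorem rightDifferential_zero : rightDifferential R X 0 = 0 := by
  simp [rightDifferential_eq]

theorem cons_tail_face_right {n : ℕ} (i : Fin (n + 1)) (x : Fin (n + 3) → X) :
    (Fin.cons (Fin.tail (face (fun _ y => y) i.succ.succ x) 0)
      (Fin.tail (face (fun _ y => y) i.succ.succ x)) : Fin (n + 2) → X) =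
      face (fun _ y => y) i.succ.succ x := by
  funext m
  refine Fin.cases ?_ (fun m => rfl) m
  have h : 1 < i.succ.succ := by simp [Fin.lt_def]
  simp [face, Fin.tail, h]

/-- The surviving faces, of index at least 2, begin with two equal entries, so a boundary is
recovered from its tail by doubling the first entry of the tail. Hence `tailMap` is injective on
boundaries. -/
theorem cons_tailMap_rightDifferential (n : ℕ) :
    (Finsupp.lmapDomain R R fun t : Fin (n + 1) → X => (Fin.cons (t 0) t : Fin (n + 2) → X)) ∘ₗ
      tailMap R X (n + 1) ∘ₗ rightDifferential R X (n + 1) = rightDifferential R X (n + 1) := by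
  rw [rightDifferential_eq]
  refine Finsupp.lhom_ext fun x c => ?_
  simp only [tailMap, LinearMap.comp_apply, LinearMap.sum_apply, LinearMap.smul_apply, map_sum,
    map_smul, Finsupp.lmapDomain_apply, Finsupp.mapDomain_single, cons_tail_face_right]

theorem disjoint_ker_tailMap : ∀ n, Disjoint (LinearMap.ker (tailMap R X n))
    (LinearMap.range (rightDifferential R X n))
  | 0 => by simp [rightDifferential_zero]
  | n + 1 => by
    rw [Submodule.disjoint_def]
    rintro _ hx ⟨w, rfl⟩
    have h := LinearMap.congr_fun (cons_tailMap_rightDifferential (R := R) (X := X) n) w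
    rw [LinearMap.comp_apply, LinearMap.comp_apply, LinearMap.mem_ker.mp hx, map_zero] at h
    exact h.symm

theorem ker_tailMap_zero :
    LinearMap.ker (tailMap R X 0) = LinearMap.ker (augmentation R X) := by
  have h₁ : augmentation R X =
      Finsupp.linearCombination R (fun _ => (1 : R)) ∘ₗ tailMap R X 0 := by
    refine Finsupp.lhom_ext fun x c => ?_
    simp [augmentation, tailMap, Finsupp.mapDomain_single]
  have h₂ : tailMap R X 0 = Finsupp.lsingle ![] ∘ₗ augmentation R X := by
    refine Finsupp.lhom_ext fun x c => ?_
    simp [augmentation, tailMap, Finsupp.mapDomain_single, Matrix.empty_eq]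
  refine le_antisymm ?_ ?_
  · rw [h₁]; exact LinearMap.ker_le_ker_comp _ _
  · rw [h₂]; exact LinearMap.ker_le_ker_comp _ _

theorem ker_rightDifferential [Nonempty X] (n : ℕ) :
    LinearMap.ker (rightDifferential R X n) =
      LinearMap.ker (tailMap R X (n + 1)) ⊔
        LinearMap.range (rightDifferential R X (n + 1)) := by
  refine le_antisymm (fun z hz => ?_) (sup_le (ker_tailMap_le n) ?_)
  · have h := LinearMap.congr_fun (tailMap_comp_rightDifferential (R := R) (X := X) n) z
    rw [LinearMap.sub_apply, LinearMap.mem_ker.mp hz, sub_zero, LinearMap.comp_apply,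
      LinearMap.comp_apply] at h
    rw [← sub_add_cancel z (rightDifferential R X (n + 1) (Finsupp.lmapDomain R R
      (fun x : Fin (n + 2) → X =>
        (Fin.cons (x 0) (Fin.cons (x 1) (Fin.tail x)) : Fin (n + 3) → X)) z))]
    refine Submodule.add_mem_sup ?_ ⟨_, rfl⟩
    rw [LinearMap.mem_ker, map_sub, h, sub_self]
  · rintro _ ⟨w, rfl⟩
    have h := LinearMap.congr_fun (differential_comp (R := R) (X := X) (k := 1)
      (ops := fun _ _ y => y) (fun _ _ _ _ _ => rfl) (fun _ => 1) n) w
    simpa [differential] using h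

theorem coeffSum_eq_zero_of_mem_ker_tailMap {n : ℕ} {z : Chain R X n}
    (hz : z ∈ LinearMap.ker (tailMap R X n)) : coeffSum R X n z = 0 := by
  have h : coeffSum R X n =
      Finsupp.linearCombination R (fun _ => (1 : R)) ∘ₗ tailMap R X n := by
    refine Finsupp.lhom_ext fun x c => ?_
    simp [coeffSum, tailMap, Finsupp.mapDomain_single]
  rw [h, LinearMap.comp_apply, LinearMap.mem_ker.mp hz, map_zero]

theorem finrank_ker_tailMap [IsDomain R] [Finite X] [Nonempty X] (n : ℕ) :
    Module.finrank R (LinearMap.ker (tailMap R X n)) + Nat.card X ^ n = Nat.card X ^ (n + 1) := by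
  have hsurj : Function.Surjective (tailMap R X n) := by
    refine Finsupp.mapDomain_surjective fun t => ?_
    exact ⟨Fin.cons (Classical.arbitrary X) t, Fin.tail_cons _ _⟩
  have := Fintype.ofFinite X
  have h := Submodule.finrank_quotient_add_finrank (LinearMap.ker (tailMap R X n))
  rw [((tailMap R X n).quotKerEquivOfSurjective hsurj).finrank_eq] at h
  simp only [Module.finrank_finsupp_self, Fintype.card_fun, Fintype.card_fin] at h
  rw [Nat.card_eq_fintype_card, add_comm, h]

end RightProjection

/-! ### The two-element lattice with scalars `(1, -1, -1, 0)`. -/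

section TwoElements

variable {L : Type*} [DistribLattice L] [BoundedOrder L]

/-- If `x i = ⊥`, join with it is the left projection and meet the right one; if `x i = ⊤`, the
roles swap. Either way left minus join minus meet leaves minus the right projection on each face. -/
theorem differential_latticeOps_two (hL : ∀ y : L, y = ⊥ ∨ y = ⊤) (n : ℕ) :
    differential (latticeOps L) ![1, -1, -1, (0 : ℤ)] n = -rightDifferential ℤ L n := by
  have hface : ∀ (i : Fin (n + 2)) (x : Fin (n + 2) → L) (c : ℤ),
      Finsupp.single (face (fun x _ : L => x) i x) c -
        Finsupp.single (face (fun x y : L => x ⊔ y) i x) c -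
        Finsupp.single (face (fun x y : L => x ⊓ y) i x) c =
      -Finsupp.single (face (fun _ y : L => y) i x) c := by
    intro i x c
    rcases hL (x i) with h | h
    · have e₁ : face (fun x y : L => x ⊔ y) i x = face (fun x _ : L => x) i x := by
        funext m; simp [face, h]
      have e₂ : face (fun x y : L => x ⊓ y) i x = face (fun _ y : L => y) i x := by
        funext m; simp [face, h]
      rw [e₁, e₂, sub_self, zero_sub]
    · have e₁ : face (fun x y : L => x ⊔ y) i x = face (fun _ y : L => y) i x := by
        funext m; simp [face, h]
      have e₂ : face (fun x y : L => x ⊓ y) i x = face (fun x _ : L => x) i x := by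
        funext m; simp [face, h]
      rw [e₁, e₂, sub_sub_cancel_left]
  refine Finsupp.lhom_ext fun x c => ?_
  simp only [differential, oneTermDifferential, rightDifferential, Fin.sum_univ_four, latticeOps,
    Matrix.cons_val, LinearMap.add_apply, LinearMap.neg_apply, LinearMap.smul_apply,
    LinearMap.sum_apply, Finsupp.lmapDomain_apply, Finsupp.mapDomain_single, Finset.smul_sum,
    ← Finset.sum_add_distrib, ← Finset.sum_neg_distrib, ← smul_neg, ← hface]
  refine Finset.sum_congr rfl fun i _ => ?_
  module

variable (hL : ∀ y : L, y = ⊥ ∨ y = ⊤)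
include hL

theorem boundaries_latticeOps_two (n : ℕ) :
    boundaries (latticeOps L) ![1, -1, -1, (0 : ℤ)] n =
      LinearMap.range (rightDifferential ℤ L n) := by
  rw [boundaries, differential_latticeOps_two hL, LinearMap.range_neg]

theorem augCycles_latticeOps_two : ∀ n : ℕ,
    augCycles (latticeOps L) ![1, -1, -1, (0 : ℤ)] n =
      LinearMap.ker (tailMap ℤ L n) ⊔ boundaries (latticeOps L) ![1, -1, -1, (0 : ℤ)] n
  | 0 => by
    rw [boundaries_latticeOps_two hL, rightDifferential_zero, LinearMap.range_zero, sup_bot_eq,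
      ker_tailMap_zero]
    rfl
  | n + 1 => by
    rw [boundaries_latticeOps_two hL, ← ker_rightDifferential, augCycles,
      differential_latticeOps_two hL, LinearMap.ker_neg]

theorem disjoint_ker_tailMap_boundaries (n : ℕ) : Disjoint (LinearMap.ker (tailMap ℤ L n))
    (boundaries (latticeOps L) ![1, -1, -1, (0 : ℤ)] n) := by
  rw [boundaries_latticeOps_two hL]
  exact disjoint_ker_tailMap n

end TwoElements

/-! ### Splitting cycles along complementary elements. -/

section Decomposition

variable {L : Type*} [DistribLattice L] {n : ℕ} {z : Chain ℤ L n}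

local notation "𝒵" => augCycles (latticeOps L) ![1, -1, -1, (0 : ℤ)]
local notation "ℬ" => boundaries (latticeOps L) ![1, -1, -1, (0 : ℤ)]

theorem chainMap_latticeHom_mem_boundaries {L' : Type*} [DistribLattice L'] (f : LatticeHom L L')
    (a : Fin 4 → ℤ) (hz : z ∈ boundaries (latticeOps L) a n) :
    chainMap ℤ f n z ∈ boundaries (latticeOps L') a n :=
  chainMap_mem_boundaries (fun r x y => by fin_cases r <;> simp [latticeOps]) a hz

theorem chainMap_latticeHom_mem_augCycles {L' : Type*} [DistribLattice L'] (f : LatticeHom L L')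
    (a : Fin 4 → ℤ) (hz : z ∈ augCycles (latticeOps L) a n) :
    chainMap ℤ f n z ∈ augCycles (latticeOps L') a n :=
  chainMap_mem_augCycles (fun r x y => by fin_cases r <;> simp [latticeOps]) a hz

/-- Meet with a fixed element, as a lattice homomorphism. -/
def infHom (y : L) : LatticeHom L L where
  toFun x := x ⊓ y
  map_sup' := by intro a b; exact inf_sup_right a b y
  map_inf' := by intro a b; exact inf_inf_distrib_right a b y

/-- Join with a fixed element, as a lattice homomorphism. -/
def supHom (y : L) : LatticeHom L L where
  toFun x := x ⊔ y
  map_sup' := by intro a b; exact sup_sup_distrib_right a b y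
  map_inf' := by intro a b; exact sup_inf_right a b y

theorem sub_sup_sub_inf_mem_boundaries (y : L) (hz : z ∈ 𝒵 n) :
    z - chainMap ℤ (supHom y) n z - chainMap ℤ (infHom y) n z ∈ ℬ n := by
  have h := rightAction_mem_boundaries (latticeOps L) ![1, -1, -1, (0 : ℤ)] y hz
  rw [rightAction_latticeOps, one_smul, neg_one_smul, neg_one_smul, ← sub_eq_add_neg,
    ← sub_eq_add_neg] at h
  exact h

variable [BoundedOrder L]

theorem chainMap_bot_mem_boundaries (hz : z ∈ 𝒵 n) :
    chainMap ℤ (fun _ : L => (⊥ : L)) n z ∈ ℬ n := by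
  have h := rightAction_mem_boundaries (latticeOps L) ![1, -1, -1, (0 : ℤ)] ⊥ hz
  rw [rightAction_bot, add_neg_cancel, zero_smul, zero_add, neg_one_mul, neg_smul,
    ← chainMap_const, neg_mem_iff] at h
  exact h

theorem chainMap_top_mem_boundaries (hz : z ∈ 𝒵 n) :
    chainMap ℤ (fun _ : L => (⊤ : L)) n z ∈ ℬ n := by
  have h := rightAction_mem_boundaries (latticeOps L) ![1, -1, -1, (0 : ℤ)] ⊤ hz
  rw [rightAction_top, add_neg_cancel, zero_smul, zero_add, neg_one_mul, neg_smul,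
    ← chainMap_const, neg_mem_iff] at h
  exact h

/-- Modulo boundaries, a cycle is the sum of its restrictions to complementary elements. -/
theorem sub_inf_sub_inf_mem_boundaries {y y' : L} (hy : IsCompl y y') (hz : z ∈ 𝒵 n) :
    z - chainMap ℤ (infHom y) n z - chainMap ℤ (infHom y') n z ∈ ℬ n := by
  have h₁ := sub_sup_sub_inf_mem_boundaries y hz
  have h₂ := chainMap_latticeHom_mem_boundaries (supHom y) _
    (sub_sup_sub_inf_mem_boundaries y' hz)
  have hz' := chainMap_latticeHom_mem_augCycles (infHom y') _ hz
  have h₃ := sub_sup_sub_inf_mem_boundaries y hz'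
  have e₁ : (supHom y ∘ supHom y' : L → L) = fun _ => ⊤ := by
    funext x
    simp [supHom, sup_assoc, hy.symm.sup_eq_top]
  have e₂ : (infHom y ∘ infHom y' : L → L) = fun _ => ⊥ := by
    funext x
    simp [infHom, inf_assoc, hy.symm.inf_eq_bot]
  simp only [map_sub, chainMap_chainMap, e₁, e₂] at h₂ h₃
  -- The terms `z ∨ y` of `h₁` and `h₂` cancel, as do the terms `(z ∧ y') ∨ y` of `h₂` and `h₃`; the
  -- constant terms at `⊤` and `⊥` are corrected by boundaries.
  have key := add_mem (sub_mem (add_mem h₁ (add_mem h₂ (chainMap_top_mem_boundaries hz))) h₃)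
    (neg_mem (chainMap_bot_mem_boundaries hz))
  convert key using 1
  abel

end Decomposition

/-! ### Power sets as sums of two-element lattices, one for each point. -/

section PowerSet

variable {A : Type*} {n : ℕ}

local notation "𝒵" => augCycles (latticeOps (Set A)) ![1, -1, -1, (0 : ℤ)] n
local notation "ℬ" => boundaries (latticeOps (Set A)) ![1, -1, -1, (0 : ℤ)] n

theorem restrict_finset_mem_boundaries {z : Chain ℤ (Set A) n} (hz : z ∈ 𝒵) (s : Finset A) :
    chainMap ℤ (infHom (s : Set A)) n z - ∑ j ∈ s, chainMap ℤ (infHom ({j} : Set A)) n z ∈ ℬ := by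
  classical
  induction s using Finset.induction_on with
  | empty =>
    have e : (infHom ((∅ : Finset A) : Set A) : Set A → Set A) = fun _ => ⊥ := by
      funext x
      simp [infHom]
    rw [e, Finset.sum_empty, sub_zero]
    exact chainMap_bot_mem_boundaries hz
  | insert j s hj ih =>
    have hz' := chainMap_latticeHom_mem_augCycles (infHom ((insert j s : Finset A) : Set A)) _ hz
    -- Within `insert j s`, the set `s` and its complement cut out `s` and `{j}`, since `j ∉ s`.
    have h := sub_inf_sub_inf_mem_boundaries (isCompl_compl (x := (s : Set A))) hz'
    have e₁ : (infHom (s : Set A) ∘ infHom ((insert j s : Finset A) : Set A) : Set A → Set A) =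
        infHom (s : Set A) := by
      funext x
      ext i
      simp [infHom]
      tauto
    have e₂ : (infHom (s : Set A)ᶜ ∘ infHom ((insert j s : Finset A) : Set A) : Set A → Set A) =
        infHom {j} := by
      funext x
      ext i
      simp [infHom]
      grind
    rw [chainMap_chainMap, chainMap_chainMap, e₁, e₂] at h
    rw [Finset.sum_insert hj]
    convert add_mem h ih using 1
    abel

/-- The projection of the power set to the coordinate `j`. -/
def coordHom (j : A) : LatticeHom (Set A) Prop where
  toFun x := j ∈ x
  map_sup' _ _ := rfl
  map_inf' _ _ := rfl

/-- The inclusion of the two-element lattice as the subsets of `{j}`. -/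
def singleHom (j : A) : LatticeHom Prop (Set A) where
  toFun p := {i | i = j ∧ p}
  map_sup' p q := by ext i; exact and_or_left
  map_inf' p q := by ext i; exact and_and_left

theorem singleHom_comp_coordHom (j : A) :
    (singleHom j ∘ coordHom j : Set A → Set A) = infHom {j} := by
  funext x
  ext i
  simp only [singleHom, coordHom, infHom, Function.comp_apply, LatticeHom.coe_mk, SupHom.coe_mk]
  change i = j ∧ j ∈ x ↔ i ∈ x ∧ i = j
  grind

theorem coordHom_comp_singleHom (j : A) : (coordHom j ∘ singleHom j : Prop → Prop) = id := by
  funext p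
  exact propext ⟨fun h => h.2, fun h => ⟨rfl, h⟩⟩

theorem coordHom_comp_singleHom_of_ne {i j : A} (h : i ≠ j) :
    (coordHom i ∘ singleHom j : Prop → Prop) = fun _ => ⊥ := by
  funext p
  exact propext ⟨fun h' => h h'.1, False.elim⟩

variable [Fintype A]

theorem sub_sum_coord_mem_boundaries {z : Chain ℤ (Set A) n} (hz : z ∈ 𝒵) :
    z - ∑ j, chainMap ℤ (singleHom j) n (chainMap ℤ (coordHom j) n z) ∈ ℬ := by
  have h := restrict_finset_mem_boundaries hz Finset.univ
  have e : (infHom ((Finset.univ : Finset A) : Set A) : Set A → Set A) = id := by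
    funext x
    simp [infHom]
  rw [e, chainMap_id] at h
  simpa only [chainMap_chainMap, singleHom_comp_coordHom] using h

/-- A family of chains of the two-element lattice annihilated by `tailMap`, summed over the
coordinates of the power set. -/
noncomputable def coordSum (A : Type*) [Fintype A] (n : ℕ) :
    (A → LinearMap.ker (tailMap ℤ Prop n)) →ₗ[ℤ] Chain ℤ (Set A) n :=
  ∑ j, chainMap ℤ (singleHom j) n ∘ₗ Submodule.subtype _ ∘ₗ LinearMap.proj j

theorem coordSum_apply (w : A → LinearMap.ker (tailMap ℤ Prop n)) :
    coordSum A n w = ∑ j, chainMap ℤ (singleHom j) n (w j : Chain ℤ Prop n) := by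
  simp [coordSum, LinearMap.sum_apply]

/-- For `j ≠ i` the composite `coordHom i ∘ singleHom j` is constant, and a constant map kills
chains with coefficient sum zero, in particular those in `ker tailMap`. -/
theorem coord_coordSum (w : A → LinearMap.ker (tailMap ℤ Prop n)) (i : A) :
    chainMap ℤ (coordHom i) n (coordSum A n w) = w i := by
  rw [coordSum_apply, map_sum, Finset.sum_eq_single i]
  · rw [chainMap_chainMap, coordHom_comp_singleHom, chainMap_id]
  · intro j _ hj
    rw [chainMap_chainMap, coordHom_comp_singleHom_of_ne hj.symm, chainMap_const,
      coeffSum_eq_zero_of_mem_ker_tailMap (w j).2, zero_smul]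
  · simp

theorem coordSum_injective : Function.Injective (coordSum A n) := fun w w' h => by
  funext i
  exact Subtype.ext (by rw [← coord_coordSum w, h, coord_coordSum])

theorem prop_eq_bot_or_eq_top (p : Prop) : p = ⊥ ∨ p = ⊤ := eq_bot_or_eq_top p

/-- Each `coordHom i` sends boundaries to boundaries and recovers `w i`, so disjointness reduces to
the two-element lattice. -/
theorem disjoint_range_coordSum : Disjoint (LinearMap.range (coordSum A n)) ℬ := by
  rw [Submodule.disjoint_def]
  rintro _ ⟨w, rfl⟩ hw
  have : w = 0 := by
    funext i
    refine Subtype.ext (Submodule.disjoint_def.mp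
      (disjoint_ker_tailMap_boundaries prop_eq_bot_or_eq_top n) _ (w i).2 ?_)
    rw [← coord_coordSum]
    exact chainMap_latticeHom_mem_boundaries (coordHom i) _ hw
  rw [this, map_zero]

theorem augCycles_powerSet : 𝒵 = LinearMap.range (coordSum A n) ⊔ ℬ := by
  refine le_antisymm (fun z hz => ?_)
    (sup_le ?_ (boundaries_le_augCycles (isDistributive_latticeOps _) _ n))
  · have h : ∀ j : A, ∃ e : LinearMap.ker (tailMap ℤ Prop n),
        chainMap ℤ (coordHom j) n z - e ∈
          boundaries (latticeOps Prop) ![1, -1, -1, (0 : ℤ)] n := by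
      intro j
      have hj := chainMap_latticeHom_mem_augCycles (coordHom j) _ hz
      rw [augCycles_latticeOps_two prop_eq_bot_or_eq_top] at hj
      obtain ⟨e, he, b, hb, heb⟩ := Submodule.mem_sup.mp hj
      exact ⟨⟨e, he⟩, by rwa [← heb, add_sub_cancel_left]⟩
    choose w hw using h
    have h₁ := sub_sum_coord_mem_boundaries hz
    have h₂ := sum_mem (t := Finset.univ) fun (j : A) _ =>
      chainMap_latticeHom_mem_boundaries (singleHom j) _ (hw j)
    simp only [map_sub, Finset.sum_sub_distrib, ← coordSum_apply] at h₂
    have h₃ := add_mem h₁ h₂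
    rw [sub_add_sub_cancel] at h₃
    rw [← add_sub_cancel (coordSum A n w) z]
    exact Submodule.add_mem_sup ⟨w, rfl⟩ h₃
  · rintro _ ⟨w, rfl⟩
    rw [coordSum_apply]
    refine sum_mem fun j _ => chainMap_latticeHom_mem_augCycles (singleHom j) _ ?_
    rw [augCycles_latticeOps_two prop_eq_bot_or_eq_top]
    exact Submodule.mem_sup_left (w j).2

theorem reducedBetti_powerSet :
    reducedBetti (latticeOps (Set A)) ![1, -1, -1, (0 : ℤ)] n = Fintype.card A * 2 ^ n := by
  have hE := finrank_ker_tailMap (R := ℤ) (X := Prop) n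
  rw [Nat.card_eq_fintype_card, Fintype.card_prop, pow_succ, mul_two, Nat.add_right_cancel_iff]
    at hE
  rw [reducedBetti, augCycles_powerSet, finrank_sup_of_disjoint disjoint_range_coordSum,
    Nat.add_sub_cancel, LinearMap.finrank_range_of_inj coordSum_injective,
    Module.finrank_pi_fintype, hE, Finset.sum_const, Finset.card_univ, smul_eq_mul]

end PowerSet

/-! ### Rescaled and zero scalars. -/

section Scaling

variable {R X : Type*} [CommRing R] {k : ℕ}

theorem differential_smul (ops : Fin k → X → X → X) (t : R) (a : Fin k → R) (n : ℕ) :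
    differential ops (t • a) n = t • differential ops a n := by
  simp [differential, Finset.smul_sum, smul_smul]

theorem reducedBetti_smul [IsDomain R] [IsNoetherianRing R] [Finite X]
    (ops : Fin k → X → X → X) {t : R} (ht : t ≠ 0) (a : Fin k → R) (n : ℕ) : reducedBetti ops (t • a) n = reducedBetti ops a n := by
  have hZ : augCycles ops (t • a) n = augCycles ops a n := by
    cases n with
    | zero => rfl
    | succ n =>
      ext z
      simp [augCycles, differential_smul, ht]
  have hB : Module.finrank R (boundaries ops (t • a) n) =
      Module.finrank R (boundaries ops a n) := by
    refine le_antisymm (Submodule.finrank_mono ?_) (finrank_le_of_smul_mem ht ?_)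
    · rintro _ ⟨w, rfl⟩
      exact ⟨t • w, by rw [differential_smul, map_smul, LinearMap.smul_apply]⟩
    · rintro _ ⟨w, rfl⟩
      exact ⟨w, by rw [differential_smul, LinearMap.smul_apply]⟩
  rw [reducedBetti, hZ, hB, reducedBetti]

theorem reducedBetti_zero_add_delta [IsDomain R] [Finite X] [Nonempty X]
    (ops : Fin k → X → X → X) (n : ℕ) :
    reducedBetti ops (0 : Fin k → R) n + delta n = Nat.card X ^ (n + 1) := by
  have := Fintype.ofFinite X
  have hd : ∀ n, differential ops (0 : Fin k → R) n = 0 := fun n => by simp [differential]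
  have hC : Module.finrank R (Chain R X n) = Nat.card X ^ (n + 1) := by
    simp only [Module.finrank_finsupp_self, Fintype.card_fun, Fintype.card_fin,
      Nat.card_eq_fintype_card]
  rw [reducedBetti, boundaries, hd, LinearMap.range_zero, finrank_bot, Nat.sub_zero, ← hC]
  cases n with
  | zero => exact finrank_ker_augmentation_add_one
  | succ n => rw [augCycles, hd, LinearMap.ker_zero, finrank_top, delta, if_neg n.succ_ne_zero,
      Nat.add_zero]

end Scaling

end DistributiveHomology

open DistributiveHomology in
theorem mainTheorem12 {A : Type*} [Finite A] (J : ℕ) (hJ : Nat.card A = J) (a b c : ℤ) (n : ℕ) :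
    (a = 0 ∧ b = 0 ∧ c = 0 →
      Module.rank ℤ (fourTermHomology (Set A) a b c 0 n) = ((2 ^ (J * (n + 1)) : ℕ) : Cardinal) ∧
      Nat.card (Set A) ^ (n + 1) = 2 ^ (J * (n + 1))) ∧
    (a ≠ 0 ∧ b = -a ∧ c = -a →
      Module.rank ℤ (fourTermHomology (Set A) a b c 0 n) =
        ((J * 2 ^ n + delta n : ℕ) : Cardinal)) ∧
    (a + b + c = 0 ∧ ¬(a = 0 ∧ b = 0 ∧ c = 0) →
      Module.rank ℤ (fourTermHomology (Set A) a b c 0 n) = 1) ∧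
    (a + b + c ≠ 0 ∧ ¬(b = -a ∧ c = -a) →
      Module.rank ℤ (fourTermHomology (Set A) a b c 0 n) = ((delta n : ℕ) : Cardinal)) ∧
    Module.rank ℤ (augmentedFourTermHomology (Set A) a b c 0 n) + ((delta n : ℕ) : Cardinal) =
      Module.rank ℤ (fourTermHomology (Set A) a b c 0 n) := by
  have := Fintype.ofFinite A
  rw [Nat.card_eq_fintype_card] at hJ
  have hcard : Nat.card (Set A) ^ (n + 1) = 2 ^ (J * (n + 1)) := by
    rw [Nat.card_eq_fintype_card, Fintype.card_set, hJ, pow_mul]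
  rw [rank_homology (isDistributive_latticeOps (Set A)),
    rank_augmentedHomology (isDistributive_latticeOps (Set A)), ← Nat.cast_add]
  refine ⟨?_, ?_, ?_, ?_, rfl⟩
  · rintro ⟨rfl, rfl, rfl⟩
    have h0 : ![0, 0, 0, (0 : ℤ)] = 0 := by simp
    rw [h0, reducedBetti_zero_add_delta, hcard]
    exact ⟨rfl, rfl⟩
  · rintro ⟨ha, rfl, rfl⟩
    have hv : ![a, -a, -a, 0] = a • ![1, -1, -1, (0 : ℤ)] := by simp
    rw [hv, reducedBetti_smul _ ha, reducedBetti_powerSet, hJ]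
  · rintro ⟨hs, h0⟩
    -- Scalars with `b = c = -a` have sum `-a`, so sum zero would force all three to vanish.
    rw [reducedBetti_latticeOps_add_delta (by grind) hs, Nat.cast_one]
  · rintro ⟨hs, h⟩
    rw [reducedBetti_latticeOps_eq_zero h hs, zero_add]
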